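/- Let $G$ be a (real) Lie group with a $C^\infty$ left action on a (Hausdorff, $C^\infty$, real) manifold $M$ of dimension $d$. Assume that the action is component effective, that is: for every $g \in G\setminus\{1_G\}$ and every connected component $M^\circ$ of $M$ there is a point $y\in M^\circ$ with $gy\neq y$. For an integer $\ell\ge 1$, let $\mathcal F^\ell M$ be the $\ell$-th order frame bundle of $M$, i.e. the set of all $\ell$-jets at $0$ of $C^\infty$ diffeomorphisms from open neighbourhoods of $0\in\mathbb R^d$ onto open subsets of $M$, and let $G$ act on $\mathcal F^\ell M$ by prolongation: $g$ sends the $\ell$-jet of $f$ to the $\ell$-jet of $u\mapsto g\,f(u)$. Then for every $\ell\geq 1$ and every $x\in\mathcal F^\ell M$, the stabilizer $\mathrm{Stab}_G(x)=\{g\in G : gx=x\}$, with the topology induced from $G$, has no compact subgroup other than the trivial one $\{1_G\}$. -/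

import Mathlib

open scoped Manifold ContDiff

namespace FrameBundles

/-- The `G`-action on the topological space `X` is component effective: for every `g ≠ 1` and every
connected component of `X`, some point of that component is moved by `g`. -/
def ComponentEffective (G X : Type*) [Group G] [TopologicalSpace X] [MulAction G X] : Prop :=
  ∀ g : G, g ≠ 1 → ∀ p : X, ∃ x ∈ connectedComponent p, g • x ≠ x

/-- `f` and `f'` have the same `k`-jet at `0 ∈ ℝᵈ`: they have the same value there and, read in the
chart of `M` at this value, the same derivatives at `0` up to order `k`. For maps that are smooth
near `0` this does not depend on the chart, see `SameJet.iteratedFDeriv_comp_eq`. -/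
def SameJet {d : ℕ} {M : Type*} [TopologicalSpace M] [ChartedSpace (EuclideanSpace ℝ (Fin d)) M]
    (k : ℕ) (f f' : EuclideanSpace ℝ (Fin d) → M) : Prop :=
  f 0 = f' 0 ∧ ∀ i ≤ k,
    iteratedFDeriv ℝ i (extChartAt (𝓡 d) (f 0) ∘ f) 0 =
      iteratedFDeriv ℝ i (extChartAt (𝓡 d) (f 0) ∘ f') 0

/-- A local parametrization of `M`: a map `ℝᵈ → M` that restricts to a smooth diffeomorphism from an
open neighbourhood of `0` to an open subset of `M` (its values far from `0` are irrelevant). -/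
structure LocalParam (d : ℕ) (M : Type*) [TopologicalSpace M]
    [ChartedSpace (EuclideanSpace ℝ (Fin d)) M] where
  toFun : EuclideanSpace ℝ (Fin d) → M
  isLocalDiffeomorphAt : IsLocalDiffeomorphAt (𝓡 d) (𝓡 d) ∞ toFun 0

/-- Having the same `k`-jet at `0` is an equivalence relation on local parametrizations. -/
def jetSetoid (d k : ℕ) (M : Type*) [TopologicalSpace M]
    [ChartedSpace (EuclideanSpace ℝ (Fin d)) M] : Setoid (LocalParam d M) where
  r f f' := SameJet k f.toFun f'.toFun
  iseqv :=
    { refl := fun _ => ⟨rfl, fun _ _ => rfl⟩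
      symm := fun h => ⟨h.1.symm, fun i hi => by rw [← h.1]; exact (h.2 i hi).symm⟩
      trans := fun h h' => ⟨h.1.trans h'.1, fun i hi => by
        rw [h.2 i hi, h.1]; exact h'.2 i hi⟩ }

/-- The `k`-th order frame bundle of the `d`-dimensional manifold `M` (as a set): the `k`-jets at `0`
of local parametrizations `ℝᵈ → M`. -/
def FrameBundle (d k : ℕ) (M : Type*) [TopologicalSpace M]
    [ChartedSpace (EuclideanSpace ℝ (Fin d)) M] : Type _ :=
  Quotient (jetSetoid d k M)

/-- The Taylor coefficients up to order `k` of a composition depend only on those of the factors. -/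
theorem iteratedFDeriv_comp_congr {E F F' : Type*} [NormedAddCommGroup E] [NormedSpace ℝ E]
    [NormedAddCommGroup F] [NormedSpace ℝ F] [NormedAddCommGroup F'] [NormedSpace ℝ F'] {k : ℕ}
    {h : F → F'} {u v : E → F} {x : E} (huv : u x = v x)
    (hu : ContDiffAt ℝ ∞ u x) (hv : ContDiffAt ℝ ∞ v x) (hh : ContDiffAt ℝ ∞ h (u x))
    (hd : ∀ i ≤ k, iteratedFDeriv ℝ i u x = iteratedFDeriv ℝ i v x) :
    ∀ i ≤ k, iteratedFDeriv ℝ i (h ∘ u) x = iteratedFDeriv ℝ i (h ∘ v) x := by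
  intro i hi
  have hi' : (i : WithTop ℕ∞) ≤ ∞ := by exact_mod_cast (le_top : (i : ℕ∞) ≤ ⊤)
  rw [iteratedFDeriv_comp hh hu hi', iteratedFDeriv_comp (huv ▸ hh) hv hi', ← huv]
  unfold FormalMultilinearSeries.taylorComp
  refine Finset.sum_congr rfl fun c _ => ?_
  unfold FormalMultilinearSeries.compAlongOrderedFinpartition
  congr 1
  funext m
  exact hd _ ((c.partSize_le m).trans hi)

section

variable {d k : ℕ} {M : Type*} [TopologicalSpace M] [ChartedSpace (EuclideanSpace ℝ (Fin d)) M]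
  [IsManifold (𝓡 d) ∞ M]

/-- If `f` and `f'` have the same `k`-jet at `0`, then so do `φ ∘ f` and `φ ∘ f'`, for every `φ` that
is smooth at `f 0`; in particular for every other chart `φ`. -/
theorem SameJet.iteratedFDeriv_comp_eq {F : Type*} [NormedAddCommGroup F] [NormedSpace ℝ F]
    {f f' : EuclideanSpace ℝ (Fin d) → M} (h : SameJet k f f')
    (hf : ContMDiffAt (𝓡 d) (𝓡 d) ∞ f 0) (hf' : ContMDiffAt (𝓡 d) (𝓡 d) ∞ f' 0)
    {φ : M → F} (hφ : ContMDiffAt (𝓡 d) 𝓘(ℝ, F) ∞ φ (f 0)) :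
    ∀ i ≤ k, iteratedFDeriv ℝ i (φ ∘ f) 0 = iteratedFDeriv ℝ i (φ ∘ f') 0 := by
  intro i hi
  set p := f 0 with hp
  set e := extChartAt (𝓡 d) p with he
  have key : ∀ g : EuclideanSpace ℝ (Fin d) → M, ContMDiffAt (𝓡 d) (𝓡 d) ∞ g 0 → g 0 = p →
      ContDiffAt ℝ ∞ (e ∘ g) 0 ∧ φ ∘ g =ᶠ[nhds 0] (φ ∘ e.symm) ∘ (e ∘ g) := by
    intro g hg hgp
    refine ⟨?_, ?_⟩
    · have h1 : ContMDiffAt (𝓡 d) (𝓡 d) ∞ e (g 0) := by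
        rw [hgp]; exact contMDiffAt_extChartAt
      exact (h1.comp 0 hg).contDiffAt
    · have h2 : ∀ᶠ y in nhds (g 0), y ∈ e.source := by
        rw [hgp]; exact extChartAt_source_mem_nhds p
      filter_upwards [hg.continuousAt.eventually h2] with y hy
      simp only [Function.comp_apply, e.left_inv hy]
  obtain ⟨c1, e1⟩ := key f hf rfl
  obtain ⟨c2, e2⟩ := key f' hf' h.1.symm
  have hh : ContDiffAt ℝ ∞ (φ ∘ e.symm) ((e ∘ f) 0) := by
    have h3 : ContMDiffAt (𝓡 d) (𝓡 d) ∞ e.symm (e p) :=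
      (contMDiffOn_extChartAt_symm p).contMDiffAt (extChartAt_target_mem_nhds p)
    have h4 : ContMDiffAt (𝓡 d) 𝓘(ℝ, F) ∞ φ (e.symm (e p)) := by
      rw [extChartAt_to_inv]; exact hφ
    exact (h4.comp (e p) h3).contDiffAt
  rw [(Filter.EventuallyEq.iteratedFDeriv ℝ e1 i).self_of_nhds,
    (Filter.EventuallyEq.iteratedFDeriv ℝ e2 i).self_of_nhds]
  refine iteratedFDeriv_comp_congr (k := k) ?_ c1 c2 hh h.2 i hi
  simp only [Function.comp_apply, ← h.1]

variable {EG HG G : Type*} [NormedAddCommGroup EG] [NormedSpace ℝ EG] [TopologicalSpace HG]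
  (I : ModelWithCorners ℝ EG HG) [Group G] [TopologicalSpace G] [ChartedSpace HG G]
  [MulAction G M] [ContMDiffSMul I (𝓡 d) ∞ G M]

/-- Each `g : G` acts on `M` by a diffeomorphism. -/
def smulDiffeomorph (g : G) : M ≃ₘ^∞⟮𝓡 d, 𝓡 d⟯ M where
  toEquiv := MulAction.toPerm g
  contMDiff_toFun :=
    (ContMDiffSMul.contMDiff_smul (I := I)).comp (contMDiff_const.prodMk contMDiff_id)
  contMDiff_invFun :=
    (ContMDiffSMul.contMDiff_smul (I := I)).comp (contMDiff_const.prodMk contMDiff_id)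

/-- The local parametrization `u ↦ g • f u`. -/
def LocalParam.translate (g : G) (f : LocalParam d M) : LocalParam d M where
  toFun u := g • f.toFun u
  isLocalDiffeomorphAt :=
    f.isLocalDiffeomorphAt.comp (𝓡 d) M ((smulDiffeomorph (d := d) (M := M) I g).isLocalDiffeomorph _)

theorem sameJet_translate (g : G) {f f' : LocalParam d M} (h : SameJet k f.toFun f'.toFun) :
    SameJet k (f.translate I g).toFun (f'.translate I g).toFun := by
  refine ⟨congrArg (g • ·) h.1, fun i hi => ?_⟩
  exact h.iteratedFDeriv_comp_eq f.isLocalDiffeomorphAt.contMDiffAt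
    f'.isLocalDiffeomorphAt.contMDiffAt
    (φ := extChartAt (𝓡 d) (g • f.toFun 0) ∘ (g • ·))
    (ContMDiffAt.comp (f.toFun 0) contMDiffAt_extChartAt
      ((smulDiffeomorph (d := d) (M := M) I g).contMDiff (f.toFun 0))) i hi

end

/-- The prolonged action of `G` on the `k`-th order frame bundle: `g` sends the `k`-jet of `f` to the
`k`-jet of `u ↦ g • f u`. -/
@[reducible]
def prolongedAction (d k : ℕ) {M : Type*} [TopologicalSpace M]
    [ChartedSpace (EuclideanSpace ℝ (Fin d)) M] [IsManifold (𝓡 d) ∞ M]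
    {EG HG : Type*} (G : Type*) [NormedAddCommGroup EG] [NormedSpace ℝ EG] [TopologicalSpace HG]
    (I : ModelWithCorners ℝ EG HG) [Group G] [TopologicalSpace G] [ChartedSpace HG G]
    [MulAction G M] [ContMDiffSMul I (𝓡 d) ∞ G M] :
    MulAction G (FrameBundle d k M) where
  smul g := Quotient.map (LocalParam.translate I g) fun _ _ h => sameJet_translate I g h
  one_smul x := by
    induction x using Quotient.inductionOn with
    | h f =>
      refine congrArg (Quotient.mk _) ?_
      simp [LocalParam.translate]
  mul_smul g g' x := by
    induction x using Quotient.inductionOn with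
    | h f =>
      refine congrArg (Quotient.mk _) ?_
      simp [LocalParam.translate, mul_smul]

/-- `Stab_G(x) = {g ∈ G | g x = x}` for a point `x` of the `k`-th order frame bundle of `M`, with
respect to the prolonged action. -/
def frameStabilizer {d k : ℕ} {M : Type*} [TopologicalSpace M]
    [ChartedSpace (EuclideanSpace ℝ (Fin d)) M] [IsManifold (𝓡 d) ∞ M]
    {EG HG : Type*} (G : Type*) [NormedAddCommGroup EG] [NormedSpace ℝ EG] [TopologicalSpace HG]
    (I : ModelWithCorners ℝ EG HG) [Group G] [TopologicalSpace G] [ChartedSpace HG G]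
    [MulAction G M] [ContMDiffSMul I (𝓡 d) ∞ G M] (x : FrameBundle d k M) : Subgroup G :=
  letI := prolongedAction d k (M := M) G I
  MulAction.stabilizer G x

end FrameBundles

namespace FrameBundles

open Filter Topology MeasureTheory Set

/-! ### The action in coordinates -/

section

variable {EG HG G : Type*} [NormedAddCommGroup EG] [NormedSpace ℝ EG]
  [TopologicalSpace HG] (I : ModelWithCorners ℝ EG HG)
  [Group G] [TopologicalSpace G] [ChartedSpace HG G]
  {d : ℕ} {M : Type*} [TopologicalSpace M]
  [ChartedSpace (EuclideanSpace ℝ (Fin d)) M] [IsManifold (𝓡 d) ∞ M]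
  [MulAction G M] [ContMDiffSMul I (𝓡 d) ∞ G M]

/-! A compact subgroup K fixing a frame fixes its base point p with identity differential: gB = B
for the invertible differential B of the parametrization (`fixesFirstOrder_of_mem_frameStabilizer`);
the higher jets play no role. Average a chart χ at p over K with respect to Haar measure. The
average Φ is K-invariant. Near p, every g in K distorts differences of χ-coordinates by a factor at
most 1/2, so Φ - χ does too, and Φ is injective. Then Φ(gy) = Φ(y) forces gy = y: K is trivial near
p (`eventually_smul_eq_of_fixesFirstOrder`). The points near which K is trivial form an open set. It
is closed as well: at a limit point K again has identity differential by continuity, and the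
averaging argument applies there. So it contains the component of p, against component
effectiveness. -/

/-- The action of `g` read in the chart of `M` at `p`. -/
noncomputable def smulInChart (d : ℕ) {G M : Type*} [TopologicalSpace M]
    [ChartedSpace (EuclideanSpace ℝ (Fin d)) M] [SMul G M] (p : M) (g : G) :
    EuclideanSpace ℝ (Fin d) → EuclideanSpace ℝ (Fin d) :=
  fun u => extChartAt (𝓡 d) p (g • (extChartAt (𝓡 d) p).symm u)

theorem contMDiffAt_extChartAt_symm_self {E H N : Type*} [NormedAddCommGroup E] [NormedSpace ℝ E]
    [TopologicalSpace H] (J : ModelWithCorners ℝ E H) [J.Boundaryless] [TopologicalSpace N]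
    [ChartedSpace H N] [IsManifold J ∞ N] (p : N) :
    ContMDiffAt 𝓘(ℝ, E) J ∞ (extChartAt J p).symm (extChartAt J p p) :=
  (contMDiffOn_extChartAt_symm p).contMDiffAt (extChartAt_target_mem_nhds p)

/-- Read in charts, the action map is smooth at `(g, p)` if `g` fixes `p`. -/
theorem contDiffAt_smul_inCharts [I.Boundaryless] [IsManifold I ∞ G] {p : M} {g : G}
    (hg : g • p = p) :
    ContDiffAt ℝ ∞ (fun z : EG × EuclideanSpace ℝ (Fin d) =>
      smulInChart d p ((extChartAt I g).symm z.1) z.2)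
      (extChartAt I g g, extChartAt (𝓡 d) p p) := by
  suffices h : ContMDiffAt (𝓘(ℝ, EG).prod 𝓘(ℝ, EuclideanSpace ℝ (Fin d)))
      𝓘(ℝ, EuclideanSpace ℝ (Fin d)) ∞ (fun z : EG × EuclideanSpace ℝ (Fin d) =>
        smulInChart d p ((extChartAt I g).symm z.1) z.2)
      (extChartAt I g g, extChartAt (𝓡 d) p p) by
    rw [← modelWithCornersSelf_prod, chartedSpaceSelf_prod] at h
    exact h.contDiffAt
  have h1 : ContMDiffAt (𝓘(ℝ, EG).prod 𝓘(ℝ, EuclideanSpace ℝ (Fin d))) I ∞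
      (fun z : EG × EuclideanSpace ℝ (Fin d) => (extChartAt I g).symm z.1)
      (extChartAt I g g, extChartAt (𝓡 d) p p) :=
    ContMDiffAt.comp _ (contMDiffAt_extChartAt_symm_self I g) contMDiffAt_fst
  have h2 : ContMDiffAt (𝓘(ℝ, EG).prod 𝓘(ℝ, EuclideanSpace ℝ (Fin d))) (𝓡 d) ∞
      (fun z : EG × EuclideanSpace ℝ (Fin d) => (extChartAt (𝓡 d) p).symm z.2)
      (extChartAt I g g, extChartAt (𝓡 d) p p) :=
    ContMDiffAt.comp _ (contMDiffAt_extChartAt_symm_self (𝓡 d) p) contMDiffAt_snd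
  have h3 := (contMDiff_smul (I := I) (I' := 𝓡 d) (n := ∞) (G := G) (M := M)).contMDiffAt.comp _
    (h1.prodMk h2)
  refine ContMDiffAt.comp (g := extChartAt (𝓡 d) p) (I' := 𝓡 d) _ ?_ h3
  simp only [extChartAt_to_inv, hg]
  exact contMDiffAt_extChartAt

include I in
theorem contDiffAt_smulInChart {p : M} {g : G} (hg : g • p = p) :
    ContDiffAt ℝ ∞ (smulInChart d p g) (extChartAt (𝓡 d) p p) := by
  rw [← contMDiffAt_iff_contDiffAt]
  have h := (smulDiffeomorph (d := d) (M := M) I g).contMDiff.contMDiffAt.comp _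
    (contMDiffAt_extChartAt_symm_self (𝓡 d) p)
  refine ContMDiffAt.comp (g := extChartAt (𝓡 d) p) (I' := 𝓡 d) _ ?_ h
  rw [extChartAt_to_inv, hg]
  exact contMDiffAt_extChartAt

/-- `g` fixes `p` to first order. -/
def FixesFirstOrder (d : ℕ) {G M : Type*} [TopologicalSpace M]
    [ChartedSpace (EuclideanSpace ℝ (Fin d)) M] [SMul G M] (p : M) (g : G) : Prop :=
  g • p = p ∧ fderiv ℝ (smulInChart d p g) (extChartAt (𝓡 d) p p) = .id ℝ _

/-- Near a point fixed to first order by `g`, all elements close to `g` move differences of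
coordinates only a little. -/
theorem FixesFirstOrder.eventually_norm_sub_le [I.Boundaryless] [IsManifold I ∞ G] {p : M} {g : G}
    (hg : FixesFirstOrder d p g) {ε : ℝ} (hε : 0 < ε) :
    ∀ᶠ z : (M × M) × G in 𝓝 ((p, p), g),
      ‖extChartAt (𝓡 d) p (z.2 • z.1.1) - extChartAt (𝓡 d) p (z.2 • z.1.2)
        - (extChartAt (𝓡 d) p z.1.1 - extChartAt (𝓡 d) p z.1.2)‖
      ≤ ε * ‖extChartAt (𝓡 d) p z.1.1 - extChartAt (𝓡 d) p z.1.2‖ := by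
  set χ := extChartAt (𝓡 d) p with hχ
  set ψ := extChartAt I g with hψ
  have hC := contDiffAt_smul_inCharts (d := d) I hg.1
  have hS := hC.hasStrictFDerivAt (by simp)
  set F := fun z : EG × EuclideanSpace ℝ (Fin d) => smulInChart d p (ψ.symm z.1) z.2
  set L := fderiv ℝ F (ψ g, χ p)
  -- Only the M-directions of `L` matter: the points compared below share their group coordinate.
  have hL : ∀ v, L (0, v) = v := by
    have h1 : HasFDerivAt (fun u : EuclideanSpace ℝ (Fin d) => F (ψ g, u))
        (L.comp (ContinuousLinearMap.inr ℝ EG _)) (χ p) :=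
      HasFDerivAt.comp (χ p) hS.hasFDerivAt (hasFDerivAt_prodMk_right (ψ g) (χ p))
    have h2 : (fun u : EuclideanSpace ℝ (Fin d) => F (ψ g, u)) = smulInChart d p g := by
      funext u
      simp only [F, hψ, extChartAt_to_inv]
    rw [h2] at h1
    intro v
    have := congrArg (fun T => T v) (h1.fderiv.symm.trans hg.2)
    simpa using this
  -- Strict differentiability lets both base points and the group element vary.
  have hb := hS.isLittleO.bound hε
  have hχc : ContinuousAt χ p := continuousAt_extChartAt p
  have hψc : ContinuousAt ψ g := continuousAt_extChartAt g
  have ht : Tendsto (fun z : (M × M) × G => ((ψ z.2, χ z.1.1), (ψ z.2, χ z.1.2)))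
      (𝓝 ((p, p), g)) (𝓝 ((ψ g, χ p), (ψ g, χ p))) := by
    have a : Tendsto (fun z : (M × M) × G => ψ z.2) (𝓝 ((p, p), g)) (𝓝 (ψ g)) :=
      hψc.tendsto.comp (continuous_snd.tendsto ((p, p), g))
    have b : Tendsto (fun z : (M × M) × G => χ z.1.1) (𝓝 ((p, p), g)) (𝓝 (χ p)) :=
      hχc.tendsto.comp ((continuous_fst.comp continuous_fst).tendsto ((p, p), g))
    have c : Tendsto (fun z : (M × M) × G => χ z.1.2) (𝓝 ((p, p), g)) (𝓝 (χ p)) :=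
      hχc.tendsto.comp ((continuous_snd.comp continuous_fst).tendsto ((p, p), g))
    exact (a.prodMk_nhds b).prodMk_nhds (a.prodMk_nhds c)
  have e1 : ∀ᶠ z : (M × M) × G in 𝓝 ((p, p), g), z.2 ∈ ψ.source :=
    (continuous_snd.tendsto ((p, p), g)).eventually (extChartAt_source_mem_nhds g)
  have e2 : ∀ᶠ z : (M × M) × G in 𝓝 ((p, p), g), z.1.1 ∈ χ.source :=
    ((continuous_fst.comp continuous_fst).tendsto ((p, p), g)).eventually
      (extChartAt_source_mem_nhds p)
  have e3 : ∀ᶠ z : (M × M) × G in 𝓝 ((p, p), g), z.1.2 ∈ χ.source :=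
    ((continuous_snd.comp continuous_fst).tendsto ((p, p), g)).eventually
      (extChartAt_source_mem_nhds p)
  filter_upwards [ht.eventually hb, e1, e2, e3] with z hz h1 h2 h3
  simpa only [F, smulInChart, ← hχ, χ.left_inv h2, χ.left_inv h3, ψ.left_inv h1, Prod.mk_sub_mk,
    sub_self, hL, Prod.norm_mk, norm_zero, norm_nonneg, max_eq_right] using hz

end

/-! ### Compact groups fixing a point to first order -/

section Compact

variable {EG HG G : Type*} [NormedAddCommGroup EG] [NormedSpace ℝ EG]
  [TopologicalSpace HG] (I : ModelWithCorners ℝ EG HG) [I.Boundaryless]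
  [Group G] [TopologicalSpace G] [ChartedSpace HG G] [LieGroup I ∞ G]
  {d : ℕ} {M : Type*} [TopologicalSpace M]
  [ChartedSpace (EuclideanSpace ℝ (Fin d)) M] [IsManifold (𝓡 d) ∞ M]
  [MulAction G M] [ContMDiffSMul I (𝓡 d) ∞ G M]

include I in
/-- A compact group that fixes a point to first order acts trivially near this point. -/
theorem eventually_smul_eq_of_fixesFirstOrder {K : Subgroup G} (hK : IsCompact (K : Set G)) {p : M}
    (hp : ∀ g ∈ K, FixesFirstOrder d p g) : ∀ᶠ y in 𝓝 p, ∀ g ∈ K, g • y = y := by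
  have : IsTopologicalGroup G := topologicalGroup_of_lieGroup I ∞
  have : ContinuousSMul G M := ContMDiffSMul.continuousSMul (I := I) (I' := 𝓡 d) ∞
  have : CompactSpace K := isCompact_iff_compactSpace.mp hK
  let _ : MeasurableSpace K := borel K
  have : BorelSpace K := ⟨rfl⟩
  set χ := extChartAt (𝓡 d) p with hχ
  set μ : Measure K := Measure.haarMeasure ⊤
  have : IsProbabilityMeasure μ := ⟨Measure.haarMeasure_self⟩
  have stay : ∀ s ∈ 𝓝 p, ∀ᶠ y in 𝓝 p, ∀ g ∈ K, g • y ∈ s := by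
    intro s hs
    refine hK.eventually_forall_of_forall_eventually fun g hg => ?_
    have : Tendsto (fun z : M × G => z.2 • z.1) (𝓝 (p, g)) (𝓝 p) := by
      have h : Continuous fun z : M × G => z.2 • z.1 := continuous_snd.smul continuous_fst
      have h' := h.tendsto (p, g)
      rwa [(hp g hg).1] at h'
    exact this hs
  -- Compactness of K makes the neighbourhood uniform in g. Any constant below 1 would serve.
  have near := hK.eventually_forall_of_forall_eventually
    (x₀ := (p, p)) (P := fun (z : M × M) (g : G) =>
      ‖χ (g • z.1) - χ (g • z.2) - (χ z.1 - χ z.2)‖ ≤ 1 / 2 * ‖χ z.1 - χ z.2‖)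
    fun g hg => (hp g hg).eventually_norm_sub_le I one_half_pos
  rw [nhds_prod_eq] at near
  obtain ⟨s, hs, hsn⟩ := (eventually_prod_self_iff (r := fun y z => ∀ g ∈ (K : Set G),
    ‖χ (g • y) - χ (g • z) - (χ y - χ z)‖ ≤ 1 / 2 * ‖χ y - χ z‖)).1 near
  have hsource : χ.source ∈ 𝓝 p := extChartAt_source_mem_nhds p
  -- Asking for the whole orbit makes `U` K-invariant, so that injectivity on `U` can compare g • y
  -- with y.
  set U := {y | ∀ g ∈ K, g • y ∈ s ∩ χ.source}
  have hU : U ∈ 𝓝 p := stay _ (inter_mem hs hsource)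
  have hUs : ∀ y ∈ U, y ∈ s ∩ χ.source := fun y hy => by simpa using hy 1 K.one_mem
  set Φ : M → EuclideanSpace ℝ (Fin d) := fun y => ∫ k : K, χ ((k : G)⁻¹ • y) ∂μ with hΦ
  have hint : ∀ y ∈ U, Integrable (fun k : K => χ ((k : G)⁻¹ • y)) μ := by
    intro y hy
    have hc : Continuous (fun k : K => χ ((k : G)⁻¹ • y)) := by
      refine (continuousOn_extChartAt (I := 𝓡 d) p).comp_continuous ?_ fun k => ?_
      · exact continuous_subtype_val.inv.smul continuous_const
      · exact (hy _ (K.inv_mem k.2)).2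
    exact hc.integrable_of_hasCompactSupport (.of_compactSpace _)
  have hinj : ∀ y ∈ U, ∀ z ∈ U, Φ y = Φ z → y = z := by
    intro y hy z hz h
    -- As `μ` has mass 1 and Φ y = Φ z, the averaged deviation is exactly χ z - χ y; it is also at
    -- most half that norm, so it vanishes.
    have e : χ z - χ y = ∫ k : K, (χ ((k : G)⁻¹ • y) - χ ((k : G)⁻¹ • z) - (χ y - χ z)) ∂μ := by
      rw [integral_sub (f := fun k : K => χ ((k : G)⁻¹ • y) - χ ((k : G)⁻¹ • z))
        ((hint y hy).sub (hint z hz)) (integrable_const _),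
        integral_sub (hint y hy) (hint z hz)]
      change _ = Φ y - Φ z - _
      simp [h]
    have b : ‖χ z - χ y‖ ≤ 1 / 2 * ‖χ y - χ z‖ := by
      rw [e]
      refine (norm_integral_le_of_norm_le_const (C := 1 / 2 * ‖χ y - χ z‖)
        (Eventually.of_forall fun k => ?_)).trans (by simp)
      exact hsn _ (hUs y hy).1 _ (hUs z hz).1 _ (K.inv_mem k.2)
    rw [norm_sub_rev] at b
    have : ‖χ y - χ z‖ = 0 := by linarith [norm_nonneg (χ y - χ z)]
    exact χ.injOn (hUs y hy).2 (hUs z hz).2 (sub_eq_zero.mp (norm_eq_zero.mp this))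
  have hinv : ∀ g ∈ K, ∀ y, Φ (g • y) = Φ y := by
    intro g hg y
    rw [hΦ]
    simp only
    -- Left invariance replaces k by gk, and (gk)⁻¹g = k⁻¹.
    rw [← integral_mul_left_eq_self (μ := μ) _ (⟨g, hg⟩ : K)]
    refine integral_congr_ae (Eventually.of_forall fun k => ?_)
    simp [mul_smul]
  filter_upwards [hU] with y hy g hg
  refine hinj _ (fun k hk => ?_) _ hy (hinv g hg y)
  rw [← mul_smul]
  exact hy _ (K.mul_mem hk hg)

include I d in
/-- The points near which a compact group acts trivially form a closed set. -/
theorem isClosed_setOf_eventually_smul_eq [T2Space M] {K : Subgroup G}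
    (hK : IsCompact (K : Set G)) :
    IsClosed {q : M | ∀ᶠ y in 𝓝 q, ∀ g ∈ K, g • y = y} := by
  rw [isClosed_iff_frequently]
  intro q hq
  have hfix : ∀ g ∈ K, g • q = q := by
    intro g hg
    have hc : Continuous fun y : M => g • y :=
      (smulDiffeomorph (d := d) (M := M) I g).contMDiff.continuous
    exact isClosed_iff_frequently.mp (isClosed_eq hc continuous_id) q
      (hq.mono fun y hy => hy.self_of_nhds g hg)
  refine eventually_smul_eq_of_fixesFirstOrder (d := d) I hK fun g hg => ⟨hfix g hg, ?_⟩
  set χ := extChartAt (𝓡 d) q with hχ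
  have hcd := contDiffAt_smulInChart (d := d) I (hfix g hg)
  have hcont : ContinuousAt (fun y => fderiv ℝ (smulInChart d q g) (χ y)) q :=
    ContinuousAt.comp (f := χ) (hcd.continuousAt_fderiv (by simp)) (continuousAt_extChartAt q)
  -- Points y with trivial action nearby accumulate at q; around χ y the coordinate expression is
  -- the identity.
  have hfr : ∃ᶠ y in 𝓝 q, fderiv ℝ (smulInChart d q g) (χ y) = .id ℝ _ := by
    refine (hq.and_eventually (extChartAt_source_mem_nhds (I := 𝓡 d) q)).mono fun y hy => ?_
    obtain ⟨hy, hys⟩ := hy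
    have hc : Tendsto χ.symm (𝓝 (χ y)) (𝓝 y) := by
      have h := (continuousAt_extChartAt_symm' (I := 𝓡 d) hys).tendsto
      rwa [← hχ, χ.left_inv hys] at h
    have : smulInChart d q g =ᶠ[𝓝 (χ y)] id := by
      filter_upwards [hc.eventually hy, extChartAt_target_mem_nhds' (χ.map_source hys)] with u hu hut
      simp only [smulInChart, ← hχ, hu g hg, χ.right_inv hut, id]
    rw [this.fderiv_eq, fderiv_id]
  by_contra hne
  exact hfr (hcont.eventually_ne hne)

end Compact

/-! ### From frames to first order -/

section Stabilizer

variable {EG HG G : Type*} [NormedAddCommGroup EG] [NormedSpace ℝ EG]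
  [TopologicalSpace HG] (I : ModelWithCorners ℝ EG HG)
  [Group G] [TopologicalSpace G] [ChartedSpace HG G]
  {d : ℕ} {M : Type*} [TopologicalSpace M]
  [ChartedSpace (EuclideanSpace ℝ (Fin d)) M] [IsManifold (𝓡 d) ∞ M]
  [MulAction G M] [ContMDiffSMul I (𝓡 d) ∞ G M]

/-- An element that fixes a jet of order at least one fixes its base point to first order. -/
theorem fixesFirstOrder_of_mem_frameStabilizer {l : ℕ} (hl : 1 ≤ l) (f : LocalParam d M) {g : G}
    (hg : g ∈ frameStabilizer G I (Quotient.mk (jetSetoid d l M) f)) :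
    FixesFirstOrder d (f.toFun 0) g := by
  have hj : SameJet l (f.translate I g).toFun f.toFun := Quotient.exact hg
  have h0 : g • f.toFun 0 = f.toFun 0 := hj.1
  refine ⟨h0, ?_⟩
  have hf := f.isLocalDiffeomorphAt
  set p := f.toFun 0
  set χ := extChartAt (𝓡 d) p with hχ
  have h1 : fderiv ℝ (χ ∘ fun u => g • f.toFun u) 0 = fderiv ℝ (χ ∘ f.toFun) 0 := by
    have h := hj.2 1 hl
    have e : (f.translate I g).toFun 0 = p := h0
    rw [e] at h
    ext1 v
    have := congrArg (fun T => T (fun _ => v)) h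
    simp only [iteratedFDeriv_one_apply] at this
    exact this
  have hB : DifferentiableAt ℝ (χ ∘ f.toFun) 0 := by
    have : ContMDiffAt (𝓡 d) (𝓡 d) ∞ (χ ∘ f.toFun) 0 :=
      ContMDiffAt.comp 0 contMDiffAt_extChartAt hf.contMDiffAt
    exact this.contDiffAt.differentiableAt (by simp)
  have hL : DifferentiableAt ℝ (smulInChart d p g) (χ p) :=
    (contDiffAt_smulInChart (d := d) I h0).differentiableAt (by simp)
  have h2 : (χ ∘ fun u => g • f.toFun u) =ᶠ[𝓝 0] smulInChart d p g ∘ (χ ∘ f.toFun) := by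
    have hs : ∀ᶠ y in 𝓝 (f.toFun 0), y ∈ χ.source := extChartAt_source_mem_nhds p
    filter_upwards [hf.contMDiffAt.continuousAt.eventually hs] with u hu
    simp only [Function.comp_apply, smulInChart, ← hχ, χ.left_inv hu]
  rw [h2.fderiv_eq, fderiv_comp 0 hL hB] at h1
  -- The local inverse of the parametrization supplies a right inverse of B, which cancels B from gB
  -- = B.
  have hC : DifferentiableAt ℝ (hf.localInverse ∘ χ.symm) (χ p) := by
    have h := contMDiffAt_extChartAt_symm_self (𝓡 d) p
    have h' : ContMDiffAt (𝓡 d) (𝓡 d) ∞ hf.localInverse (χ.symm (χ p)) := by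
      rw [hχ, extChartAt_to_inv]; exact hf.localInverse_contMDiffAt
    exact (ContMDiffAt.comp _ h' h).contDiffAt.differentiableAt (by simp)
  have hC0 : (hf.localInverse ∘ χ.symm) (χ p) = 0 := by
    simp only [Function.comp_apply, hχ, extChartAt_to_inv]
    exact hf.localInverse_eventuallyEq_left.self_of_nhds
  have h3 : (χ ∘ f.toFun) ∘ (hf.localInverse ∘ χ.symm) =ᶠ[𝓝 (χ p)] id := by
    have hc : Tendsto χ.symm (𝓝 (χ p)) (𝓝 p) := by
      have h := (continuousAt_extChartAt_symm (I := 𝓡 d) p).tendsto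
      rwa [extChartAt_to_inv] at h
    filter_upwards [hc.eventually hf.localInverse_eventuallyEq_right,
      extChartAt_target_mem_nhds p] with u hu hut
    simp only [Function.comp_apply, id] at hu ⊢
    rw [hu, χ.right_inv hut]
  have h4 : (fderiv ℝ (χ ∘ f.toFun) 0).comp (fderiv ℝ (hf.localInverse ∘ χ.symm) (χ p))
      = .id ℝ _ := by
    have h := fderiv_comp (χ p) (g := χ ∘ f.toFun) (by rw [hC0]; exact hB) hC
    rw [hC0] at h
    rw [← h, h3.fderiv_eq, fderiv_id]
  calc fderiv ℝ (smulInChart d p g) (χ p)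
      = (fderiv ℝ (smulInChart d p g) (χ p)).comp ((fderiv ℝ (χ ∘ f.toFun) 0).comp
          (fderiv ℝ (hf.localInverse ∘ χ.symm) (χ p))) := by rw [h4]; rfl
    _ = .id ℝ _ := by
      rw [← ContinuousLinearMap.comp_assoc]
      exact (congrArg (ContinuousLinearMap.comp · _) h1).trans h4

end Stabilizer

end FrameBundles

theorem mainTheorem4
    {EG HG G : Type*} [NormedAddCommGroup EG] [NormedSpace ℝ EG] [FiniteDimensional ℝ EG]
    [TopologicalSpace HG] (I : ModelWithCorners ℝ EG HG) [I.Boundaryless]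
    [Group G] [TopologicalSpace G] [T2Space G] [ChartedSpace HG G] [LieGroup I ∞ G]
    {d : ℕ} {M : Type*} [TopologicalSpace M] [T2Space M]
    [ChartedSpace (EuclideanSpace ℝ (Fin d)) M] [IsManifold (𝓡 d) ∞ M]
    [MulAction G M] [ContMDiffSMul I (𝓡 d) ∞ G M]
    (hG : FrameBundles.ComponentEffective G M)
    (l : ℕ) (hl : 1 ≤ l) (x : FrameBundles.FrameBundle d l M)
    (K : Subgroup (FrameBundles.frameStabilizer G I x))
    (hK : IsCompact (K : Set (FrameBundles.frameStabilizer G I x))) :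
    K = ⊥ := by
  obtain ⟨f, rfl⟩ := Quotient.exists_rep x
  have hKc : IsCompact ((K.map (Subgroup.subtype _) : Subgroup G) : Set G) := by
    rw [Subgroup.coe_map]
    exact hK.image continuous_subtype_val
  have hp : ∀ g ∈ K.map (Subgroup.subtype _), FrameBundles.FixesFirstOrder d (f.toFun 0) g := by
    rintro _ ⟨k, -, rfl⟩
    exact FrameBundles.fixesFirstOrder_of_mem_frameStabilizer I hl f k.2
  -- Openness is automatic for a condition required on a neighbourhood.
  have hclopen : IsClopen {q : M | ∀ᶠ y in nhds q, ∀ g ∈ K.map (Subgroup.subtype _), g • y = y} :=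
    ⟨FrameBundles.isClosed_setOf_eventually_smul_eq (d := d) I hKc,
      isOpen_setOfPred_eventually_nhds⟩
  have hsub := hclopen.connectedComponent_subset
    (FrameBundles.eventually_smul_eq_of_fixesFirstOrder I hKc hp)
  refine (Subgroup.eq_bot_iff_forall K).mpr fun k hk => Subtype.ext ?_
  by_contra hne
  obtain ⟨y, hy, hky⟩ := hG (k : G) hne (f.toFun 0)
  exact hky ((hsub hy).self_of_nhds _ (Subgroup.mem_map_of_mem (Subgroup.subtype _) hk))
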